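/- Let $1<p<\infty$ and $b\ge p$ be real numbers. A function $u$ belongs to $W^2_p(\mathbb R)$ if $u$ and its weak derivatives $u',u''$ belong to $L_p(\mathbb R)$; equations are understood almost everywhere. Let $Lu=u''-2bxu'-2u$. (1) There exists $f\in L_p(\mathbb R)$ such that the equation $Lu=-2f$ has no solution $u\in W^2_p(\mathbb R)$. (2) In fact, this is the case for every $f\in L_p(\mathbb R)$ such that $f\ge 0$ a.e. on $\mathbb R$ and $f\ge1$ a.e. on $(0,1)$. (3) Consequently, the threshold $\lambda_0$ in the solvability theorem for elliptic equations with growing drift cannot be taken arbitrarily small. Precisely, let $c\in[0,2]$ be a constant and $L_cu=u''-2bxu'-cu$. (a) For all $\delta\in(0,1]$, $K\ge\max(1,c)$, $\varepsilon_0>0$ and $\gamma_a,\gamma_b\in(0,1]$ there is $\alpha\in(0,1]$ such that the coefficients $a\equiv1$, $\beta(x)=-2bx$, $c$ of $L_c$ satisfy the hypotheses of that theorem: they are measurable; $0\le c\le K$; $\delta|\xi|^2\le a(x)\xi^2\le K|\xi|^2$ for all $x,\xi\in\mathbb R$; with $q=\max(1,p)$, the function $|\beta|^q$ is locally integrable and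 $$\alpha^{-1}\int_{-\alpha}^{\alpha}\int_{-\alpha}^{\alpha}|\beta(x+y)-\beta(x+z)|^q\,dz\,dy\le\gamma_b\quad\text{for all }x\in\mathbb R;$$ and $$\varepsilon^{-2}\int_{-\varepsilon}^{\varepsilon}\int_{-\varepsilon}^{\varepsilon}|a(x+y)-a(x+z)|\,dz\,dy\le\gamma_a\quad\text{for all }x\in\mathbb R,\ \varepsilon\in(0,\varepsilon_0].$$ (b) If $\lambda_0\in\mathbb R$ is such that for every $\lambda\ge\lambda_0$ and every $f\in L_p(\mathbb R)$ the equation $L_cu-\lambda u=f$ has a solution $u\in W^2_p(\mathbb R)$, then $\lambda_0>2-c$. -/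

import Mathlib

open MeasureTheory

/-- `v` is the weak (distributional) derivative on `ℝ` of the locally integrable function `u`. -/
def IsWeakDeriv (u v : ℝ → ℝ) : Prop :=
  LocallyIntegrable u volume ∧ LocallyIntegrable v volume ∧
    ∀ φ : ℝ → ℝ, ContDiff ℝ (⊤ : ℕ∞) φ → HasCompactSupport φ →
      ∫ x, u x * deriv φ x = -∫ x, v x * φ x

/-- `u ∈ W²ₚ(ℝ)`, with weak first derivative `v` and weak second derivative `w`. -/
structure HasW2Derivs (p : ℝ) (u v w : ℝ → ℝ) : Prop where
  memLp : MemLp u (ENNReal.ofReal p) volume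
  memLp_deriv : MemLp v (ENNReal.ofReal p) volume
  memLp_deriv2 : MemLp w (ENNReal.ofReal p) volume
  weakDeriv : IsWeakDeriv u v
  weakDeriv2 : IsWeakDeriv v w

/-- The function `u` lies in the Sobolev space `W²ₚ(ℝ)` and satisfies `a u'' + β u' - c u = g`
almost everywhere, the derivatives being weak ones. -/
def IsW2Solution (p : ℝ) (a β c g u : ℝ → ℝ) : Prop :=
  ∃ v w : ℝ → ℝ, HasW2Derivs p u v w ∧
    ∀ᵐ x : ℝ, a x * w x + β x * v x - c x * u x = g x

/-- The hypotheses of the elliptic solvability theorem in dimension `d = 1` on the operator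
`L u = a u'' + β u' - c u`, where `q = d ∨ p = max 1 p`. -/
structure EllipticAssumptions (p δ K ε₀ γa γb α : ℝ) (a β c : ℝ → ℝ) : Prop where
  measurable_a : Measurable a
  measurable_β : Measurable β
  measurable_c : Measurable c
  c_nonneg : ∀ x, 0 ≤ c x
  c_le : ∀ x, c x ≤ K
  elliptic : ∀ x ξ : ℝ, δ * |ξ| ^ 2 ≤ a x * ξ * ξ ∧ a x * ξ * ξ ≤ K * |ξ| ^ 2
  drift_integrable : LocallyIntegrable (fun x => |β x| ^ (max 1 p)) volume
  drift_osc : ∀ x : ℝ,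
    α⁻¹ * ∫ y in Metric.ball (0 : ℝ) α, ∫ z in Metric.ball (0 : ℝ) α,
      |β (x + y) - β (x + z)| ^ (max 1 p) ≤ γb
  leading_osc : ∀ ε : ℝ, 0 < ε → ε ≤ ε₀ → ∀ x : ℝ,
    (ε ^ 2)⁻¹ * ∫ y in Metric.ball (0 : ℝ) ε, ∫ z in Metric.ball (0 : ℝ) ε,
      |a (x + y) - a (x + z)| ≤ γa

/-- `lam₀` is an admissible threshold for the existence part of the elliptic theorem: for every
`lam ≥ lam₀` and every `f ∈ Lₚ(ℝ)` the equation `a u'' + β u' - c u - lam u = f` has a solution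
in `W²ₚ(ℝ)`. -/
def SolvableFrom (p : ℝ) (a β c : ℝ → ℝ) (lam₀ : ℝ) : Prop :=
  ∀ lam : ℝ, lam₀ ≤ lam → ∀ f : ℝ → ℝ, MemLp f (ENNReal.ofReal p) volume →
    ∃ u : ℝ → ℝ, IsW2Solution p a β (fun x => c x + lam) f u

/-! With `E = exp (-b x²)` the equation takes the divergence form `(E u')' = E (2u - 2f)`, which for
the `C¹` representative `U` of a `W²ₚ` solution holds after integration
(`IsW2Solution.exists_continuous_rep`). This suffices for a maximum principle (`subsolution_le`),
although `u''` exists only almost everywhere. Membership in `Lₚ` replaces boundary values at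
infinity, since it yields arbitrarily remote points where `U` is small.

Let `f ≥ 0`. The function `φ = x ^ (-1 / b)` satisfies `-2 b x φ' - 2 φ = 0` and `φ'' > 0` on the
positive half-line, so it is a subsolution there. If `U R > 0` for some `R > 0`, comparison gives `U
≥ ε φ` beyond `R`; but `φ ^ p = x ^ (-p / b)` is not integrable at infinity when `p ≤ b`. Otherwise
`U ≤ 0` on the positive half-line, while comparison with `0` gives `U ≥ 0` everywhere. Hence `U`
vanishes for `x > 0` and the equation forces `f = 0` there, contrary to `f ≥ 1` on `(0, 1)`.

The threshold bound follows because `L_c - (2 - c)` is `L` itself. -/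

/-! ### Minimum principle in integrated form. -/

open Set Filter Topology in
/-- A continuous function cannot have an interior negative minimum on `[a, b]` if its weighted
derivative is strictly decreasing on every interval where the function is negative. -/
theorem not_interior_neg_min_of_weighted_deriv {h k E : ℝ → ℝ} {a b z : ℝ}
    (hc : ContinuousOn h (Icc a b)) (hd : ∀ t ∈ Ioo a b, HasDerivAt h (k t) t)
    (hE : ∀ t, 0 < E t)
    (hmono : ∀ x y, a < x → x < y → y < b → (∀ t ∈ Icc x y, h t < 0) →
      E y * k y < E x * k x)
    (haz : a < z) (hzb : z < b) (hz : h z < 0) (hza : h z < h a) (hzb' : h z < h b) : False := by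
  obtain ⟨x₀, hx₀, hmin⟩ := isCompact_Icc.exists_isMinOn (nonempty_Icc.2 (haz.trans hzb).le) hc
  have hle : h x₀ ≤ h z := hmin ⟨haz.le, hzb.le⟩
  have hax : a < x₀ := lt_of_le_of_ne hx₀.1 (by rintro rfl; linarith)
  have hxb : x₀ < b := lt_of_le_of_ne hx₀.2 (by rintro rfl; linarith)
  have hk : k x₀ = 0 :=
    (hmin.isLocalMin (Icc_mem_nhds hax hxb)).hasDerivAt_eq_zero (hd x₀ ⟨hax, hxb⟩)
  have hneg : ∀ᶠ t in 𝓝 x₀, h t < 0 ∧ t < b :=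
    ((hd x₀ ⟨hax, hxb⟩).continuousAt.eventually_lt continuousAt_const (by linarith)).and
      (eventually_lt_nhds hxb)
  obtain ⟨r, hr, hball⟩ := Metric.eventually_nhds_iff.1 hneg
  have hin : ∀ t ∈ Icc x₀ (x₀ + r / 2), h t < 0 ∧ t < b := fun t ht =>
    hball (by rw [Real.dist_eq, abs_lt]; constructor <;> linarith [ht.1, ht.2])
  -- `E * k` vanishes at the minimum point `x₀` and strictly decreases to its right while `h < 0`;
  -- so `h` would drop below its minimum.
  have hanti : StrictAntiOn h (Icc x₀ (x₀ + r / 2)) := by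
    refine strictAntiOn_of_deriv_neg (convex_Icc _ _)
      (fun t ht => (hd t ⟨hax.trans_le ht.1, (hin t ht).2⟩).continuousAt.continuousWithinAt) ?_
    intro t ht
    rw [interior_Icc] at ht
    have ht' : t ∈ Icc x₀ (x₀ + r / 2) := Ioo_subset_Icc_self ht
    rw [(hd t ⟨hax.trans ht.1, (hin t ht').2⟩).deriv]
    have := hmono x₀ t hax ht.1 (hin t ht').2 fun s hs => (hin s ⟨hs.1, hs.2.trans ht'.2⟩).1
    rw [hk, mul_zero] at this
    exact (pos_iff_neg_of_mul_neg this).1 (hE t)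
  have hr2 : x₀ < x₀ + r / 2 := by linarith
  have h1 := hanti (left_mem_Icc.2 hr2.le) (right_mem_Icc.2 hr2.le) hr2
  have h2 : h x₀ ≤ h (x₀ + r / 2) :=
    hmin ⟨(hax.trans hr2).le, (hin _ (right_mem_Icc.2 hr2.le)).2.le⟩
  linarith

/-! ### Weak derivatives on the line and primitives. -/

/-- Integration by parts for a primitive of a locally integrable function against a `C¹`
function. -/
theorem integral_primitive_mul_deriv {v G : ℝ → ℝ} (hv : LocallyIntegrable v volume)
    (hG : ContDiff ℝ 1 G) (C a b : ℝ) :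
    ∫ x in a..b, (C + ∫ t in (0 : ℝ)..x, v t) * deriv G x =
      (C + ∫ t in (0 : ℝ)..b, v t) * G b - (C + ∫ t in (0 : ℝ)..a, v t) * G a -
        ∫ x in a..b, v x * G x := by
  have hi : ∀ x y, IntervalIntegrable v volume x y := fun x y =>
    hv.integrableOn_isCompact isCompact_uIcc |>.intervalIntegrable
  -- The primitive is based at `0`, so absolute continuity is obtained on an interval containing
  -- `0`, `a` and `b`, then restricted.
  set A := min 0 (min a b)
  set B := max 0 (max a b)
  have hFac : AbsolutelyContinuousOnInterval (fun x => C + ∫ t in (0 : ℝ)..x, v t) a b := by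
    have h0 : (0 : ℝ) ∈ Set.uIcc A B := by
      rw [Set.mem_uIcc]; exact Or.inl ⟨min_le_left _ _, le_max_left _ _⟩
    have h1 := (hi A B).absolutelyContinuousOnInterval_intervalIntegral h0
    have hc : AbsolutelyContinuousOnInterval (fun _ : ℝ => C) A B :=
      (contDiff_const.contDiffOn (n := 1)).absolutelyContinuousOnInterval
    refine (hc.add h1).mono (Set.uIcc_subset_uIcc ?_ ?_) <;> rw [Set.mem_uIcc] <;> left <;>
      simp [A, B]
  have hGac : AbsolutelyContinuousOnInterval G a b := hG.contDiffOn.absolutelyContinuousOnInterval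
  rw [hFac.integral_mul_deriv_eq_deriv_mul hGac]
  congr 1
  refine intervalIntegral.integral_congr_ae ?_
  filter_upwards [_root_.LocallyIntegrable.ae_hasDerivAt_integral hv] with x hx _
  rw [((hx 0).const_add C).deriv]

/-- A test function with vanishing integral is the derivative of a test function. -/
theorem exists_test_primitive {ψ : ℝ → ℝ} (hψ : ContDiff ℝ (⊤ : ℕ∞) ψ)
    (hs : HasCompactSupport ψ) (h0 : ∫ x, ψ x = 0) :
    ∃ φ : ℝ → ℝ, ContDiff ℝ (⊤ : ℕ∞) φ ∧ HasCompactSupport φ ∧ deriv φ = ψ := by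
  obtain ⟨R, hR, hsub⟩ := hs.isCompact.isBounded.subset_ball_lt 0 0
  have hz : ∀ x, R ≤ |x| → ψ x = 0 := fun x hx => by
    by_contra hne
    have := hsub (subset_tsupport _ hne)
    rw [Metric.mem_ball, Real.dist_eq, sub_zero] at this
    linarith
  have hd : ∀ x, HasDerivAt (fun x => ∫ t in (-R)..x, ψ t) (ψ x) x := fun x =>
    intervalIntegral.integral_hasDerivAt_right (hψ.continuous.intervalIntegrable _ _)
      hψ.continuous.stronglyMeasurable.stronglyMeasurableAtFilter hψ.continuous.continuousAt
  have hderiv : deriv (fun x => ∫ t in (-R)..x, ψ t) = ψ := funext fun x => (hd x).deriv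
  refine ⟨fun x => ∫ t in (-R)..x, ψ t, ?_, ?_, hderiv⟩
  · refine contDiff_infty_iff_deriv.2 ⟨fun x => (hd x).differentiableAt, ?_⟩
    rw [hderiv]; exact hψ
  · refine HasCompactSupport.intro (isCompact_Icc (a := -R) (b := R)) fun x hx => ?_
    rw [Set.mem_Icc, not_and_or, not_le, not_le] at hx
    rcases hx with hx | hx
    · refine (intervalIntegral.integral_congr (g := fun _ => 0) fun t ht => ?_).trans (by simp)
      rw [Set.uIcc_of_ge hx.le] at ht
      exact hz t (by rw [abs_of_nonpos] <;> linarith [ht.2])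
    · rw [← h0]
      refine intervalIntegral.integral_eq_integral_of_support_subset fun t ht => ?_
      have : |t| < R := not_le.1 fun h => ht (hz t h)
      rw [abs_lt] at this
      exact ⟨this.1, by linarith⟩

/-- The lemma of du Bois-Reymond. -/
theorem ae_const_of_integral_mul_deriv_eq_zero {g : ℝ → ℝ} (hg : LocallyIntegrable g volume)
    (h : ∀ φ : ℝ → ℝ, ContDiff ℝ (⊤ : ℕ∞) φ → HasCompactSupport φ → ∫ x, g x * deriv φ x = 0) :
    ∃ C, ∀ᵐ x, g x = C := by
  let η : ContDiffBump (0 : ℝ) := ⟨1, 2, one_pos, by norm_num⟩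
  set θ : ℝ → ℝ := η.normed volume
  have hθ : ContDiff ℝ (⊤ : ℕ∞) θ := η.contDiff_normed
  have hθs : HasCompactSupport θ := η.hasCompactSupport_normed
  have hθ1 : ∫ x, θ x = 1 := η.integral_normed
  have hint : ∀ φ : ℝ → ℝ, ContDiff ℝ (⊤ : ℕ∞) φ → HasCompactSupport φ →
      Integrable φ ∧ Integrable fun x => g x * φ x := fun φ hφ hφs =>
    ⟨hφ.continuous.integrable_of_hasCompactSupport hφs,
      by simpa [mul_comm] using hg.integrable_smul_left_of_hasCompactSupport hφ.continuous hφs⟩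
  set C := ∫ x, g x * θ x
  refine ⟨C, ?_⟩
  have key := ae_eq_zero_of_integral_contDiff_smul_eq_zero (f := fun x => g x - C)
    (hg.sub (locallyIntegrable_const C)) fun ψ hψ hψs => ?_
  · filter_upwards [key] with x hx using sub_eq_zero.1 hx
  · obtain ⟨iψ, igψ⟩ := hint ψ hψ hψs
    obtain ⟨iθ, igθ⟩ := hint θ hθ hθs
    -- Subtracting a multiple of the unit-mass bump `θ` makes the mean zero, so the hypothesis on
    -- derivatives applies to an arbitrary `ψ`.
    obtain ⟨φ, hφ, hφs, hd⟩ := exists_test_primitive (ψ := fun x => ψ x - (∫ y, ψ y) * θ x)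
      (hψ.sub (contDiff_const.mul hθ)) (hψs.sub hθs.mul_left)
      (by rw [integral_sub iψ (iθ.const_mul _), integral_const_mul, hθ1]; ring)
    have h1 := h φ hφ hφs
    rw [hd] at h1
    have e1 : (fun x => g x * (ψ x - (∫ y, ψ y) * θ x)) =
        fun x => g x * ψ x - (∫ y, ψ y) * (g x * θ x) := by funext x; ring
    have e2 : (fun x => ψ x • (g x - C)) = fun x => g x * ψ x - C * ψ x := by
      funext x; simp only [smul_eq_mul]; ring
    rw [e1, integral_sub igψ (igθ.const_mul _), integral_const_mul] at h1
    rw [e2, integral_sub igψ (iψ.const_mul _), integral_const_mul]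
    linarith

/-- A function with a weak derivative is almost everywhere a primitive of it. -/
theorem IsWeakDeriv.exists_ae_eq_primitive {u v : ℝ → ℝ} (h : IsWeakDeriv u v) :
    ∃ C, ∀ᵐ x, u x = C + ∫ t in (0 : ℝ)..x, v t := by
  obtain ⟨hu, hv, hw⟩ := h
  have hFc : Continuous fun x => ∫ t in (0 : ℝ)..x, v t :=
    intervalIntegral.continuous_primitive
      (fun x y => (hv.integrableOn_isCompact isCompact_uIcc).intervalIntegrable) 0
  obtain ⟨C, hC⟩ := ae_const_of_integral_mul_deriv_eq_zero
    (g := fun x => u x - ∫ t in (0 : ℝ)..x, v t) (hu.sub hFc.locallyIntegrable)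
    fun φ hφ hφs => by
      have hdc : Continuous (deriv φ) := hφ.continuous_deriv (by simp)
      have i1 : Integrable fun x => u x * deriv φ x := by
        simpa [mul_comm] using hu.integrable_smul_left_of_hasCompactSupport hdc hφs.deriv
      have i2 : Integrable fun x => (∫ t in (0 : ℝ)..x, v t) * deriv φ x :=
        (hFc.mul hdc).integrable_of_hasCompactSupport hφs.deriv.mul_left
      have e : (fun x => (u x - ∫ t in (0 : ℝ)..x, v t) * deriv φ x) =
          fun x => u x * deriv φ x - (∫ t in (0 : ℝ)..x, v t) * deriv φ x := by
        funext x; ring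
      rw [e, integral_sub i1 i2, hw φ hφ hφs]
      obtain ⟨R, hR, hsub⟩ := hφs.isCompact.isBounded.subset_ball_lt 0 0
      have hball : tsupport φ ⊆ Set.Ioo (-R) R := by
        intro x hx
        have := hsub hx
        rw [Real.ball_eq_Ioo] at this
        simpa using this
      have hz : ∀ x, R ≤ |x| → φ x = 0 := fun x hx => by
        by_contra hne
        have := hball (subset_tsupport _ hne)
        linarith [abs_lt.2 this]
      have := integral_primitive_mul_deriv hv (hφ.of_le (by simp)) 0 (-R) R
      rw [hz R (le_abs_self R), hz (-R) (by rw [abs_neg]; exact le_abs_self R)] at this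
      simp only [zero_add, mul_zero, sub_zero, zero_sub] at this
      rw [intervalIntegral.integral_eq_integral_of_support_subset,
        intervalIntegral.integral_eq_integral_of_support_subset] at this
      · rw [this]; ring
      · intro x hx
        exact Set.Ioo_subset_Ioc_self (hball (subset_tsupport _ (right_ne_zero_of_mul hx)))
      · intro x hx
        exact Set.Ioo_subset_Ioc_self
          (hball (support_deriv_subset (right_ne_zero_of_mul hx)))
  exact ⟨C, hC.mono fun x hx => by linarith⟩

/-! ### Divergence form of the equation. -/

/-- The integrating factor of the operator `u'' - 2 b x u'`. -/
noncomputable def gaussWeight (b x : ℝ) : ℝ := Real.exp (-(b * x ^ 2))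

theorem gaussWeight_pos (b x : ℝ) : 0 < gaussWeight b x := Real.exp_pos _

theorem contDiff_gaussWeight (b : ℝ) : ContDiff ℝ 1 (gaussWeight b) := by
  unfold gaussWeight; fun_prop

theorem continuous_gaussWeight (b : ℝ) : Continuous (gaussWeight b) :=
  (contDiff_gaussWeight b).continuous

theorem hasDerivAt_gaussWeight (b x : ℝ) :
    HasDerivAt (gaussWeight b) (-2 * b * x * gaussWeight b x) x := by
  have := (((hasDerivAt_pow 2 x).const_mul b).neg).exp
  unfold gaussWeight
  convert! this using 1
  simp only [Pi.neg_apply]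
  push_cast; ring

/-- A `W²ₚ` solution of `u'' - 2 b x u' - 2 u = -2 f` has a `C¹` representative `U` for which the
equation holds in integrated divergence form. -/
theorem IsW2Solution.exists_continuous_rep {p b : ℝ} {f u : ℝ → ℝ}
    (h : IsW2Solution p (fun _ => 1) (fun x => -2 * b * x) (fun _ => 2) (fun x => -2 * f x) u) :
    ∃ U V : ℝ → ℝ, (∀ x, HasDerivAt U (V x) x) ∧ (∀ᵐ x, u x = U x) ∧
      MemLp u (ENNReal.ofReal p) volume ∧ ∀ x y,
        IntervalIntegrable (fun t => gaussWeight b t * (2 * U t - 2 * f t)) volume x y ∧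
        ∫ t in x..y, gaussWeight b t * (2 * U t - 2 * f t) =
          gaussWeight b y * V y - gaussWeight b x * V x := by
  obtain ⟨v, w, ⟨hu, -, -, huv, hvw⟩, heq⟩ := h
  obtain ⟨C, hC⟩ := huv.exists_ae_eq_primitive
  obtain ⟨D, hD⟩ := hvw.exists_ae_eq_primitive
  have hw := hvw.2.1
  have hi : ∀ x y, IntervalIntegrable w volume x y := fun x y =>
    (hw.integrableOn_isCompact isCompact_uIcc).intervalIntegrable
  set V : ℝ → ℝ := fun x => D + ∫ t in (0 : ℝ)..x, w t with hVdef
  have hV : Continuous V := continuous_const.add (intervalIntegral.continuous_primitive hi 0)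
  set U : ℝ → ℝ := fun x => C + ∫ t in (0 : ℝ)..x, V t with hUdef
  have huU : ∀ᵐ x, u x = U x := by
    filter_upwards [hC] with x hx
    rw [hx, hUdef]
    simp only [add_right_inj]
    exact intervalIntegral.integral_congr_ae (hD.mono fun t ht _ => ht)
  refine ⟨U, V, fun x => ?_, huU, hu, fun x y => ?_⟩
  · exact (intervalIntegral.integral_hasDerivAt_right (hV.intervalIntegrable _ _)
      hV.stronglyMeasurable.stronglyMeasurableAtFilter hV.continuousAt).const_add C
  · have hae : ∀ᵐ t, V t * deriv (gaussWeight b) t + w t * gaussWeight b t =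
        gaussWeight b t * (2 * U t - 2 * f t) := by
      filter_upwards [huU, hD, heq] with t h1 h2 h3
      rw [(hasDerivAt_gaussWeight b t).deriv, ← h1]
      change v t = V t at h2
      rw [← h2]
      linear_combination gaussWeight b t * h3
    have hdc : Continuous (deriv (gaussWeight b)) :=
      (contDiff_gaussWeight b).continuous_deriv le_rfl
    have i1 : IntervalIntegrable (fun t => V t * deriv (gaussWeight b) t) volume x y :=
      (hV.mul hdc).intervalIntegrable _ _
    have i2 : IntervalIntegrable (fun t => w t * gaussWeight b t) volume x y :=
      (hi x y).mul_continuousOn (continuous_gaussWeight b).continuousOn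
    refine ⟨(i1.add i2).congr_ae (ae_restrict_of_ae hae), ?_⟩
    rw [← intervalIntegral.integral_congr_ae (hae.mono fun t ht _ => ht),
      intervalIntegral.integral_add i1 i2,
      integral_primitive_mul_deriv hw (contDiff_gaussWeight b) D x y]
    simp only [hVdef]
    ring

/-! ### Comparison with subsolutions. -/

/-- A function in `Lₚ` takes small values on every set of infinite measure. -/
theorem exists_mem_abs_lt_of_memLp {p : ℝ} (hp : 0 < p) {u U : ℝ → ℝ}
    (hu : MemLp u (ENNReal.ofReal p) volume) (huU : ∀ᵐ x, u x = U x) {s : Set ℝ}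
    (hs : volume s = ⊤) {m : ℝ} (hm : 0 < m) : ∃ x ∈ s, |U x| < m := by
  by_contra! hcon
  have hU : MemLp U (ENNReal.ofReal p) volume := (memLp_congr_ae huU).1 hu
  have hlt := hU.meas_ge_lt_top (by simpa using hp) ENNReal.ofReal_ne_top
    (ε := ⟨m, hm.le⟩) (fun h => hm.ne' (congrArg NNReal.toReal h))
  refine absurd (measure_mono (μ := volume) (fun x hx => ?_)) (not_le.2 (hs ▸ hlt))
  exact hcon x hx

/-- Comparison of a solution with a subsolution `φ` of the homogeneous equation. -/
theorem subsolution_le {b x₁ x₂ z : ℝ} {f U V φ φ' : ℝ → ℝ}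
    (hU : ∀ x, HasDerivAt U (V x) x)
    (hV : ∀ x y, IntervalIntegrable (fun t => gaussWeight b t * (2 * U t - 2 * f t)) volume x y ∧
        ∫ t in x..y, gaussWeight b t * (2 * U t - 2 * f t) =
          gaussWeight b y * V y - gaussWeight b x * V x)
    (hf : ∀ᵐ x, 0 ≤ f x)
    (hφc : ContinuousOn φ (Set.Icc x₁ x₂)) (hφ : ∀ t ∈ Set.Ioo x₁ x₂, HasDerivAt φ (φ' t) t)
    (hφ' : ∀ x y, x₁ < x → x < y → y < x₂ → ∫ t in x..y, gaussWeight b t * (2 * φ t) ≤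
      gaussWeight b y * φ' y - gaussWeight b x * φ' x)
    (h1 : x₁ < z) (h2 : z < x₂) (hz : U z < φ z) (hz1 : U z - φ z < U x₁ - φ x₁)
    (hz2 : U z - φ z < U x₂ - φ x₂) : False := by
  have hUc : Continuous U := continuous_iff_continuousAt.2 fun x => (hU x).continuousAt
  refine not_interior_neg_min_of_weighted_deriv (h := fun t => U t - φ t)
    (k := fun t => V t - φ' t) (E := gaussWeight b) (hUc.continuousOn.sub hφc)
    (fun t ht => (hU t).sub (hφ t ht)) (gaussWeight_pos b) ?_ h1 h2 (sub_neg.2 hz) hz1 hz2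
  intro x y hx hxy hy hneg
  have iU : IntervalIntegrable (fun t => gaussWeight b t * (2 * U t)) volume x y :=
    ((continuous_gaussWeight b).mul (continuous_const.mul hUc)).intervalIntegrable _ _
  have iφ : IntervalIntegrable (fun t => gaussWeight b t * (2 * φ t)) volume x y := by
    refine ContinuousOn.intervalIntegrable_of_Icc hxy.le
      ((continuous_gaussWeight b).continuousOn.mul (continuousOn_const.mul (hφc.mono ?_)))
    exact Set.Icc_subset_Icc hx.le hy.le
  have e1 : gaussWeight b y * V y - gaussWeight b x * V x ≤
      ∫ t in x..y, gaussWeight b t * (2 * U t) := by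
    rw [← (hV x y).2]
    refine intervalIntegral.integral_mono_ae hxy.le (hV x y).1 iU (hf.mono fun t ht => ?_)
    exact mul_le_mul_of_nonneg_left (by linarith) (gaussWeight_pos b t).le
  have e2 := hφ' x y hx hxy hy
  -- The zero-order term `-2u` supplies the strict decrease of the weighted derivative wherever `U <
  -- φ`.
  have e3 : 0 < ∫ t in x..y, (gaussWeight b t * (2 * φ t) - gaussWeight b t * (2 * U t)) := by
    refine intervalIntegral.intervalIntegral_pos_of_pos_on (iφ.sub iU) (fun t ht => ?_) hxy
    have := hneg t (Set.Ioo_subset_Icc_self ht)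
    rw [← mul_sub]
    exact mul_pos (gaussWeight_pos b t) (by linarith)
  rw [intervalIntegral.integral_sub iφ iU] at e3
  simp only [mul_sub]
  linarith

/-- On the positive half-line `x ^ (-1 / b)` is a subsolution of `u'' - 2 b x u' - 2 u = 0`. -/
theorem rpow_subsolution {b ε x y : ℝ} (hb : 0 < b) (hε : 0 ≤ ε) (hx : 0 < x) (hxy : x ≤ y) :
    ∫ t in x..y, gaussWeight b t * (2 * (ε * t ^ (-(1 / b)))) ≤
      gaussWeight b y * (ε * (-(1 / b) * y ^ (-(1 / b) - 1))) -
        gaussWeight b x * (ε * (-(1 / b) * x ^ (-(1 / b) - 1))) := by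
  have hpos : ∀ t ∈ Set.Icc x y, 0 < t := fun t ht => hx.trans_le ht.1
  have hc : ∀ r : ℝ, ContinuousOn (fun t : ℝ => t ^ r) (Set.Icc x y) := fun r t ht =>
    (Real.continuousAt_rpow_const t r (Or.inl (hpos t ht).ne')).continuousWithinAt
  have hE := (continuous_gaussWeight b).continuousOn (s := Set.Icc x y)
  set g : ℝ → ℝ := fun t => -2 * b * t * gaussWeight b t * (ε * (-(1 / b) * t ^ (-(1 / b) - 1))) +
    gaussWeight b t * (ε * (-(1 / b) * ((-(1 / b) - 1) * t ^ (-(1 / b) - 1 - 1))))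
  have hg : ContinuousOn g (Set.Icc x y) := by
    have := hc (-(1 / b) - 1)
    have := hc (-(1 / b) - 1 - 1)
    fun_prop
  have hd : ∀ t ∈ Set.uIcc x y, HasDerivAt
      (fun t => gaussWeight b t * (ε * (-(1 / b) * t ^ (-(1 / b) - 1)))) (g t) t := by
    intro t ht
    rw [Set.uIcc_of_le hxy] at ht
    exact (hasDerivAt_gaussWeight b t).mul
      (((Real.hasDerivAt_rpow_const (Or.inl (hpos t ht).ne')).const_mul _).const_mul ε)
  rw [← intervalIntegral.integral_eq_sub_of_hasDerivAt hd (hg.intervalIntegrable_of_Icc hxy)]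
  refine intervalIntegral.integral_mono_on hxy ?_ (hg.intervalIntegrable_of_Icc hxy) ?_
  · refine ContinuousOn.intervalIntegrable_of_Icc hxy ?_
    have := hc (-(1 / b))
    fun_prop
  · intro t ht
    have ht0 := hpos t ht
    have e : t ^ (-(1 / b) - 1) * t = t ^ (-(1 / b)) := by
      rw [← Real.rpow_add_one ht0.ne']; congr 1; ring
    have hbb : b * (1 / b) = 1 := by field_simp
    -- The drift term gives exactly `2 φ`; what remains is `E φ'' ≥ 0`.
    have e2 : g t = gaussWeight b t * (2 * (ε * t ^ (-(1 / b)))) +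
        gaussWeight b t * (ε * ((1 / b) * ((1 / b + 1) * t ^ (-(1 / b) - 1 - 1)))) := by
      simp only [g]
      rw [← e]
      linear_combination (2 * t * gaussWeight b t * ε * t ^ (-(1 / b) - 1)) * hbb
    rw [e2]
    have := gaussWeight_pos b t
    have : 0 ≤ gaussWeight b t * (ε * ((1 / b) * ((1 / b + 1) * t ^ (-(1 / b) - 1 - 1)))) := by
      positivity
    linarith

/-- For `p ≤ b` no nonzero multiple of `x ^ (-1 / b)` is dominated near infinity by a function
in `Lₚ`. -/
theorem not_rpow_le_of_memLp {p b ε R : ℝ} (hp : 0 < p) (hb : p ≤ b) (hε : 0 < ε) (hR : 0 < R)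
    {U : ℝ → ℝ} (hU : MemLp U (ENNReal.ofReal p) volume)
    (h : ∀ x, R < x → ε * x ^ (-(1 / b)) ≤ U x) : False := by
  have hint := (hU.integrable_norm_rpow (by simpa using hp) ENNReal.ofReal_ne_top).integrableOn
    (s := Set.Ioi R)
  rw [ENNReal.toReal_ofReal hp.le] at hint
  have : IntegrableOn (fun x : ℝ => ε ^ p * x ^ (-(p / b))) (Set.Ioi R) := by
    refine Integrable.mono' hint (by fun_prop) ?_
    filter_upwards [ae_restrict_mem measurableSet_Ioi] with x hx
    have hx0 : 0 < x := hR.trans hx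
    have e : ε ^ p * x ^ (-(p / b)) = (ε * x ^ (-(1 / b))) ^ p := by
      rw [Real.mul_rpow hε.le (by positivity), ← Real.rpow_mul hx0.le]
      congr 2; ring
    rw [e, Real.norm_of_nonneg (by positivity)]
    exact Real.rpow_le_rpow (by positivity) ((h x hx).trans (le_abs_self _)) hp.le
  have h2 : IntegrableOn (fun x : ℝ => x ^ (-(p / b))) (Set.Ioi R) := by
    have h3 := Integrable.const_mul this (ε ^ p)⁻¹
    refine h3.congr (Filter.Eventually.of_forall fun x => ?_)
    have : ε ^ p ≠ 0 := (Real.rpow_pos_of_pos hε p).ne'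
    simp only []
    field_simp
  have := (integrableOn_Ioi_rpow_iff hR).1 h2
  have : p / b ≤ 1 := (div_le_one (hp.trans_le hb)).2 hb
  linarith

/-! ### Nonsolvability. -/

/-- Nonsolvability of `u'' - 2 b x u' - 2 u = -2 f` in `W²ₚ(ℝ)` for `b ≥ p`. -/
theorem not_exists_isW2Solution {p b : ℝ} (hp : 1 < p) (hb : p ≤ b) {f : ℝ → ℝ}
    (hf : ∀ᵐ x : ℝ, 0 ≤ f x) (hf1 : ∀ᵐ x : ℝ, x ∈ Set.Ioo (0 : ℝ) 1 → 1 ≤ f x) :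
    ¬ ∃ u : ℝ → ℝ, IsW2Solution p (fun _ => 1) (fun x => -2 * b * x) (fun _ => 2)
        (fun x => -2 * f x) u := by
  rintro ⟨u, hu⟩
  obtain ⟨U, V, hU, huU, hLp, hV⟩ := hu.exists_continuous_rep
  have hp0 : 0 < p := by linarith
  have hb0 : 0 < b := by linarith
  by_cases hpos : ∃ R > 0, 0 < U R
  · obtain ⟨R, hR, hUR⟩ := hpos
    have hφR : 0 < R ^ (-(1 / b)) := Real.rpow_pos_of_pos hR _
    set ε := U R / R ^ (-(1 / b)) with hε
    have hε0 : 0 < ε := div_pos hUR hφR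
    refine not_rpow_le_of_memLp hp0 hb hε0 hR ((memLp_congr_ae huU).1 hLp) fun z hz => ?_
    by_contra! hlt
    -- Half the gap at `z`: at `x₂` both `|U|` and the barrier are below it, so `U - φ` is larger
    -- there than at `z`.
    have hm : 0 < (ε * z ^ (-(1 / b)) - U z) / 2 := by linarith
    have htend : Filter.Tendsto (fun x : ℝ => ε * x ^ (-(1 / b))) Filter.atTop (nhds 0) := by
      simpa using (tendsto_rpow_neg_atTop (one_div_pos.2 hb0)).const_mul ε
    obtain ⟨N, hN⟩ := Filter.eventually_atTop.1 (htend.eventually_lt_const hm)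
    obtain ⟨x₂, hx₂, hUx₂⟩ := exists_mem_abs_lt_of_memLp hp0 hLp huU
      (Real.volume_Ioi (a := max N z)) hm
    have hx2N : N < x₂ := (le_max_left _ _).trans_lt hx₂
    have hzx2 : z < x₂ := (le_max_right _ _).trans_lt hx₂
    have hp' : ∀ t, R ≤ t → t ≠ 0 := fun t ht => (hR.trans_le ht).ne'
    refine subsolution_le (x₁ := R) (x₂ := x₂) (φ := fun t => ε * t ^ (-(1 / b)))
      (φ' := fun t => ε * (-(1 / b) * t ^ (-(1 / b) - 1))) hU hV hf ?_ ?_ ?_ hz hzx2 hlt ?_ ?_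
    · exact fun t ht => ((Real.continuousAt_rpow_const t _
        (Or.inl (hp' t ht.1))).const_mul ε).continuousWithinAt
    · exact fun t ht => (Real.hasDerivAt_rpow_const (Or.inl (hp' t ht.1.le))).const_mul ε
    · exact fun x y hx hxy _ => rpow_subsolution hb0 hε0.le (hR.trans hx) hxy.le
    · have : ε * R ^ (-(1 / b)) = U R := by rw [hε]; field_simp
      simp only [this]; linarith
    · have := hN x₂ hx2N.le
      have := (abs_lt.1 hUx₂).1
      linarith
  · push Not at hpos
    have hnn : ∀ z, 0 ≤ U z := by
      intro z
      by_contra! hz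
      obtain ⟨x₁, hx₁, hU1⟩ := exists_mem_abs_lt_of_memLp hp0 hLp huU
        (Real.volume_Iio (a := z)) (neg_pos.2 hz)
      obtain ⟨x₂, hx₂, hU2⟩ := exists_mem_abs_lt_of_memLp hp0 hLp huU
        (Real.volume_Ioi (a := z)) (neg_pos.2 hz)
      have := (abs_lt.1 hU1).1
      have := (abs_lt.1 hU2).1
      exact subsolution_le (x₁ := x₁) (x₂ := x₂) (φ := fun _ => 0) (φ' := fun _ => 0) hU hV hf
        continuousOn_const (fun t _ => hasDerivAt_const t 0) (by simp) hx₁ hx₂ hz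
        (by linarith) (by linarith)
    have hU0 : ∀ x, 0 < x → U x = 0 := fun x hx => le_antisymm (hpos x hx) (hnn x)
    have hV0 : ∀ x, 0 < x → V x = 0 := fun x hx =>
      (hU x).unique ((hasDerivAt_const x (0 : ℝ)).congr_of_eventuallyEq
        ((eventually_gt_nhds hx).mono hU0))
    -- Any compact subinterval of `(0, 1)` would do: the flux `E V` vanishes at both ends, yet the
    -- integrand is at most `-E` almost everywhere in between.
    obtain ⟨hi, he⟩ := hV (1 / 4) (3 / 4)
    rw [hV0 _ (by norm_num), hV0 _ (by norm_num)] at he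
    have iE : IntervalIntegrable (gaussWeight b) volume (1 / 4) (3 / 4) :=
      (continuous_gaussWeight b).intervalIntegrable _ _
    have h1 : ∫ t in (1 / 4 : ℝ)..(3 / 4), gaussWeight b t * (2 * U t - 2 * f t) ≤
        ∫ t in (1 / 4 : ℝ)..(3 / 4), -gaussWeight b t := by
      refine intervalIntegral.integral_mono_ae_restrict (by norm_num) hi iE.neg ?_
      filter_upwards [ae_restrict_of_ae hf1, ae_restrict_mem measurableSet_Icc] with t ht htI
      have := ht ⟨by linarith [htI.1], by linarith [htI.2]⟩
      rw [hU0 t (by linarith [htI.1])]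
      nlinarith [gaussWeight_pos b t]
    have h2 : 0 < ∫ t in (1 / 4 : ℝ)..(3 / 4), gaussWeight b t :=
      intervalIntegral.intervalIntegral_pos_of_pos_on iE (fun t _ => gaussWeight_pos b t)
        (by norm_num)
    rw [intervalIntegral.integral_neg] at h1
    linarith

/-! ### The coefficient hypotheses and the threshold. -/

/-- A linear drift satisfies the oscillation hypotheses of the elliptic theorem. -/
theorem exists_ellipticAssumptions_linear_drift {p b c δ K ε₀ γa γb : ℝ} (hp : 0 ≤ p)
    (hb : 1 ≤ b) (hc : 0 ≤ c) (hδ : δ ≤ 1) (hK : 1 ≤ K) (hcK : c ≤ K) (hγa : 0 < γa)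
    (hγb : 0 < γb) (hγb1 : γb ≤ 1) :
    ∃ α : ℝ, 0 < α ∧ α ≤ 1 ∧ EllipticAssumptions p δ K ε₀ γa γb α
      (fun _ => 1) (fun x => -2 * b * x) (fun _ => c) := by
  have hq : (0 : ℝ) ≤ max 1 p := hp.trans (le_max_right _ _)
  -- On a ball of radius `α` the drift oscillates by at most `4 b α = γb ≤ 1`, so its power is at
  -- most `1` whatever the exponent; the normalized double integral is then at most `4 α = γb / b ≤
  -- γb`.
  have hα : 0 < γb / (4 * b) := by positivity
  have hαb : 4 * b * (γb / (4 * b)) = γb := by field_simp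
  set α := γb / (4 * b)
  refine ⟨α, hα, by nlinarith, measurable_const, by fun_prop, measurable_const, fun _ => hc,
    fun _ => hcK, fun x ξ => ?_, ?_, fun x => ?_, fun ε _ _ x => ?_⟩
  · rw [sq_abs]
    constructor <;> nlinarith [sq_nonneg ξ]
  · refine Continuous.locallyIntegrable ?_
    exact Continuous.rpow_const (by fun_prop) fun x => Or.inr hq
  · have hball : volume (Metric.ball (0 : ℝ) α) < ⊤ := measure_ball_lt_top
    have hvol : volume.real (Metric.ball (0 : ℝ) α) = 2 * α := by
      rw [Real.volume_real_ball hα.le]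
    have hpt : ∀ y ∈ Metric.ball (0 : ℝ) α, ∀ z ∈ Metric.ball (0 : ℝ) α,
        ‖|-2 * b * (x + y) - -2 * b * (x + z)| ^ max 1 p‖ ≤ 1 := by
      intro y hy z hz
      rw [Metric.mem_ball, Real.dist_eq, sub_zero, abs_lt] at hy hz
      rw [Real.norm_of_nonneg (by positivity)]
      refine Real.rpow_le_one (abs_nonneg _) ?_ hq
      rw [abs_le]
      constructor <;> nlinarith
    have hin : ∀ y ∈ Metric.ball (0 : ℝ) α,
        ‖∫ z in Metric.ball (0 : ℝ) α,
          |-2 * b * (x + y) - -2 * b * (x + z)| ^ max 1 p‖ ≤ 2 * α := fun y hy =>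
      (norm_setIntegral_le_of_norm_le_const hball (hpt y hy)).trans (by rw [hvol, one_mul])
    have hout := (le_abs_self _).trans (norm_setIntegral_le_of_norm_le_const hball hin)
    rw [hvol] at hout
    refine (mul_le_mul_of_nonneg_left hout (inv_nonneg.2 hα.le)).trans ?_
    have : α⁻¹ * (2 * α * (2 * α)) = 4 * α := by field_simp; ring
    rw [this]
    nlinarith
  · simpa using hγa.le

theorem mainTheorem5 (p b : ℝ) (hp : 1 < p) (hb : p ≤ b) :
    -- some right-hand side in `Lₚ` admits no solution of `u'' - 2 b x u' - 2 u = -2 f`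
    (∃ f : ℝ → ℝ, MemLp f (ENNReal.ofReal p) volume ∧
      ¬ ∃ u : ℝ → ℝ, IsW2Solution p (fun _ => 1) (fun x => -2 * b * x) (fun _ => 2)
        (fun x => -2 * f x) u) ∧
    -- every `f ∈ Lₚ` with `f ≥ 0` on `ℝ` and `f ≥ 1` on `(0, 1)` is such a right-hand side
    (∀ f : ℝ → ℝ, MemLp f (ENNReal.ofReal p) volume →
      (∀ᵐ x : ℝ, 0 ≤ f x) → (∀ᵐ x : ℝ, x ∈ Set.Ioo (0 : ℝ) 1 → 1 ≤ f x) →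
      ¬ ∃ u : ℝ → ℝ, IsW2Solution p (fun _ => 1) (fun x => -2 * b * x) (fun _ => 2)
        (fun x => -2 * f x) u) ∧
    -- `u'' - 2 b x u' - c u` satisfies the hypotheses of the elliptic theorem for all values of
    -- the parameters, with a suitable `α`, yet its threshold is larger than `2 - c`
    (∀ c : ℝ, 0 ≤ c → c ≤ 2 →
      (∀ δ K ε₀ γa γb : ℝ, 0 < δ → δ ≤ 1 → 1 ≤ K → c ≤ K → 0 < ε₀ →
        0 < γa → γa ≤ 1 → 0 < γb → γb ≤ 1 →
        ∃ α : ℝ, 0 < α ∧ α ≤ 1 ∧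
          EllipticAssumptions p δ K ε₀ γa γb α
            (fun _ => 1) (fun x => -2 * b * x) (fun _ => c)) ∧
      (∀ lam₀ : ℝ, SolvableFrom p (fun _ => 1) (fun x => -2 * b * x) (fun _ => c) lam₀ →
        2 - c < lam₀)) := by
  set χ : ℝ → ℝ := Set.indicator (Set.Ioo 0 1) fun _ => 1
  have hχLp : MemLp χ (ENNReal.ofReal p) volume :=
    memLp_indicator_const _ measurableSet_Ioo 1 (Or.inr (by simp))
  have hχ0 : ∀ᵐ x : ℝ, 0 ≤ χ x :=
    .of_forall fun x => Set.indicator_nonneg (fun _ _ => zero_le_one) x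
  have hχ1 : ∀ᵐ x : ℝ, x ∈ Set.Ioo (0 : ℝ) 1 → 1 ≤ χ x :=
    .of_forall fun x hx => (Set.indicator_of_mem hx fun _ : ℝ => (1 : ℝ)).ge
  have hχ := not_exists_isW2Solution hp hb hχ0 hχ1
  refine ⟨⟨χ, hχLp, hχ⟩, fun f _ hf hf1 => not_exists_isW2Solution hp hb hf hf1,
    fun c hc _ => ⟨fun δ K ε₀ γa γb _ hδ hK hcK _ hγa _ hγb hγb1 => ?_, fun lam₀ hlam => ?_⟩⟩
  · exact exists_ellipticAssumptions_linear_drift (by linarith) (by linarith) hc hδ hK hcK hγa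
      hγb hγb1
  · by_contra! hle
    obtain ⟨u, hu⟩ := hlam (2 - c) hle (fun x => -2 * χ x) (hχLp.const_mul (-2))
    exact hχ ⟨u, by simpa using hu⟩
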